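/- All graphs are finite and simple. Write $2P_3$ for the disjoint union of two copies of the path $P_3$ on three vertices, and call a graph $2P_3$-free if none of its induced subgraphs is isomorphic to $2P_3$. A graph is $4$-vertex-critical if it is $4$-colorable but not $3$-colorable, and every proper induced subgraph of it is $3$-colorable. A minimal list-obstruction is a pair $(G,L)$, where $G$ is a graph and $L$ assigns to each vertex $v$ of $G$ a set $L(v)\subseteq\{1,2,3\}$, such that $G$ has no proper coloring $c$ with $c(v)\in L(v)$ for all $v\in V(G)$, but every proper induced subgraph of $G$ has such a coloring from the restricted lists. It is called $2P_3$-free if $G$ is. (1) There is an integer $C>0$ such that every $2P_3$-free $4$-vertex-critical graph has at most $C$ vertices. Consequently, there are, up to isomorphism, only finitely many $2P_3$-free $4$-vertex-critical graphs. (2) The corresponding statement for lists fails: for every integer $C\ge 0$ there is a $2P_3$-free minimal list-obstruction with more than $C$ vertices. In particular, there are, up to isomorphism (graph isomorphisms that preserve the lists), infinitely many $2P_3$-free minimal list-obstructions. -/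

import Mathlib

universe u

/-- The graph `2P₃`: the disjoint union of two paths on three vertices. -/
def twoPathThree : SimpleGraph (Fin 3 ⊕ Fin 3) :=
  SimpleGraph.pathGraph 3 ⊕g SimpleGraph.pathGraph 3

/-- `G` is `H`-free: no induced subgraph of `G` is isomorphic to `H`. -/
def InducedFree {W V : Type*} (H : SimpleGraph W) (G : SimpleGraph V) : Prop :=
  ¬ H.IsIndContained G

/-- `G` is `k`-chromatic (`1 ≤ k`): it is `k`-colorable but not `(k-1)`-colorable. -/
def IsChromatic {V : Type*} (G : SimpleGraph V) (k : ℕ) : Prop :=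
  G.Colorable k ∧ ¬ G.Colorable (k - 1)

/-- `G` is `k`-vertex-critical (`1 ≤ k`): it is `k`-chromatic, and every proper induced subgraph
is `(k-1)`-colorable. -/
def IsVertexCritical {V : Type*} (G : SimpleGraph V) (k : ℕ) : Prop :=
  IsChromatic G k ∧ ∀ X : Set V, X ≠ Set.univ → (G.induce X).Colorable (k - 1)

/-- The pair `(G, L)` is colorable: `G` has a proper coloring `c` with `c v ∈ L v` for all `v`.
The three colors `1, 2, 3` are represented by the elements of `Fin 3`. -/
def ListColorable {V : Type*} (G : SimpleGraph V) (L : V → Finset (Fin 3)) : Prop :=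
  ∃ c : G.Coloring (Fin 3), ∀ v, c v ∈ L v

/-- `(G, L)` is a minimal list-obstruction: it is not colorable, but every proper induced subgraph
of `G` is colorable from the restricted lists. -/
def IsMinimalListObstruction {V : Type*} (G : SimpleGraph V) (L : V → Finset (Fin 3)) : Prop :=
  ¬ ListColorable G L ∧
    ∀ X : Set V, X ≠ Set.univ → ListColorable (G.induce X) (fun v : X => L v)

/-- The pairs `(G, L)` and `(G', L')` are isomorphic: some graph isomorphism preserves the lists. -/
def ListIsomorphic {V W : Type*} (G : SimpleGraph V) (L : V → Finset (Fin 3))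
    (G' : SimpleGraph W) (L' : W → Finset (Fin 3)) : Prop :=
  ∃ φ : G ≃g G', ∀ v, L' (φ v) = L v

/-! A `4`-vertex-critical graph containing `K₄` is `K₄`. Otherwise it has a dominating set `A` of at
most 24 vertices (`exists_dominating`). Start with an induced `P₃`: the vertices it does not
dominate induce a disjoint union of cliques, and in each of three rounds seven more vertices hit or
dominate part of every such clique, lowering the clique number of the undominated part.

Fix one of the boundedly many colorings of `A`. All other vertices keep at most two colors, so
failure to extend is a 2-SAT contradiction found by propagating forced colors. It suffices to bound
shortest propagation sequences (`forcesIn_bounded`). Colors refuted by few vertices are deleted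
beforehand, so a long sequence can be colored both forwards and backwards, which with minimality
restricts its chords to one cyclic pattern of colors. Two distant repetitions of the same list give
`2P₃` (`not_two_stays`), and so does a long stretch without repetition, which is periodic modulo 3
(`IsPeriodicRun.length_lt`). The witnesses for all colorings of `A`, with `A`, form an uncolorable
subgraph of bounded size; by criticality it is the whole graph.

For lists, a path with forced colors `0, 1, 2, 0, …` is a minimal obstruction of any length
divisible by 3, and half-graph chords make it `2P₃`-free without spoiling minimality. -/

theorem InducedFree.false_of_paths {V : Type*} {G : SimpleGraph V}
    (h : InducedFree twoPathThree G) {x y z x' y' z' : V}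
    (hxy : G.Adj x y) (hyz : G.Adj y z) (hne : x ≠ z) (hxz : ¬ G.Adj x z)
    (hxy' : G.Adj x' y') (hyz' : G.Adj y' z') (hne' : x' ≠ z') (hxz' : ¬ G.Adj x' z')
    (h₁ : ¬ G.Adj x x') (h₂ : ¬ G.Adj x y') (h₃ : ¬ G.Adj x z')
    (h₄ : ¬ G.Adj y x') (h₅ : ¬ G.Adj y y') (h₆ : ¬ G.Adj y z')
    (h₇ : ¬ G.Adj z x') (h₈ : ¬ G.Adj z y') (h₉ : ¬ G.Adj z z') : False := by
  have n₁ : x ≠ x' := by rintro rfl; exact h₄ hxy.symm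
  have n₂ : x ≠ y' := by rintro rfl; exact h₅ hxy.symm
  have n₃ : x ≠ z' := by rintro rfl; exact h₆ hxy.symm
  have n₄ : y ≠ x' := by rintro rfl; exact h₁ hxy
  have n₅ : y ≠ y' := by rintro rfl; exact h₂ hxy
  have n₆ : y ≠ z' := by rintro rfl; exact h₃ hxy
  have n₇ : z ≠ x' := by rintro rfl; exact h₄ hyz
  have n₈ : z ≠ y' := by rintro rfl; exact h₅ hyz
  have n₉ : z ≠ z' := by rintro rfl; exact h₆ hyz
  refine h ⟨⟨⟨Sum.elim ![x, y, z] ![x', y', z'], ?_⟩, ?_⟩⟩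
  · have inj : ∀ {p q r : V}, p ≠ q → q ≠ r → p ≠ r → Function.Injective ![p, q, r] := by
      intro p q r h₁ h₂ h₃ i j hij
      fin_cases i <;> fin_cases j <;> simp_all
    refine (inj hxy.ne hyz.ne hne).sumElim (inj hxy'.ne hyz'.ne hne') fun i j => ?_
    fin_cases i <;> fin_cases j <;> assumption
  · rintro (i | i) (j | j) <;> fin_cases i <;> fin_cases j <;>
      simp [twoPathThree, SimpleGraph.pathGraph_adj, hxy, hxy.symm, hyz, hyz.symm, hxz,
        mt G.adj_symm hxz, hxy', hxy'.symm, hyz', hyz'.symm, hxz', mt G.adj_symm hxz', h₁, h₂, h₃, h₄,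
        h₅,
        h₆, h₇, h₈, h₉, mt G.adj_symm h₁, mt G.adj_symm h₂, mt G.adj_symm h₃, mt G.adj_symm h₄,
        mt G.adj_symm h₅,
        mt G.adj_symm h₆, mt G.adj_symm h₇, mt G.adj_symm h₈, mt G.adj_symm h₉]

theorem exists_paths_of_not_inducedFree {V : Type*} {G : SimpleGraph V}
    (h : ¬ InducedFree twoPathThree G) : ∃ x y z x' y' z' : V,
    G.Adj x y ∧ G.Adj y z ∧ x ≠ z ∧ ¬ G.Adj x z ∧
    G.Adj x' y' ∧ G.Adj y' z' ∧ x' ≠ z' ∧ ¬ G.Adj x' z' ∧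
    ¬ G.Adj x x' ∧ ¬ G.Adj x y' ∧ ¬ G.Adj x z' ∧
    ¬ G.Adj y x' ∧ ¬ G.Adj y y' ∧ ¬ G.Adj y z' ∧
    ¬ G.Adj z x' ∧ ¬ G.Adj z y' ∧ ¬ G.Adj z z' := by
  obtain ⟨φ⟩ := not_not.1 h
  refine ⟨φ (.inl 0), φ (.inl 1), φ (.inl 2), φ (.inr 0), φ (.inr 1), φ (.inr 2), ?_⟩
  have hφ : ∀ a b, G.Adj (φ a) (φ b) ↔ twoPathThree.Adj a b := fun a b => φ.map_rel_iff
  simp only [hφ, φ.injective.ne_iff]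
  simp [twoPathThree, SimpleGraph.pathGraph_adj]

/-! ### Arbitrarily large minimal list-obstructions -/

/-- The adjacency relation of a path on the naturals, with additional edges from every
`i ≡ 1` to every later `j ≡ 0` modulo `3`. -/
def HalfGraphRel (i j : ℕ) : Prop :=
  i + 1 = j ∨ j + 1 = i ∨ (i % 3 = 1 ∧ j % 3 = 0 ∧ i + 2 ≤ j) ∨ (j % 3 = 1 ∧ i % 3 = 0 ∧ j + 2 ≤ i)

theorem HalfGraphRel.symm {x y : ℕ} (h : HalfGraphRel x y) : HalfGraphRel y x := by
  unfold HalfGraphRel at *; omega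

/-- The graph of `HalfGraphRel` on a type enumerated by `Fin n`. -/
def halfGraph {V : Type*} {n : ℕ} (e : V ≃ Fin n) : SimpleGraph V where
  Adj x y := HalfGraphRel (e x) (e y)
  symm := ⟨fun _ _ h => h.symm⟩
  loopless := ⟨fun x h => by unfold HalfGraphRel at h; omega⟩

/-- The two colors allowed at position `i` of the half graph on `n` vertices, a single one
at the ends. -/
def halfGraphList (n i : ℕ) : Finset (Fin 3) :=
  Finset.univ.filter fun c =>
    (c.val = i % 3 ∧ i + 1 ≠ n) ∨ (c.val = (i + 2) % 3 ∧ i ≠ 0)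

theorem halfGraphRel_of_mod {p q : ℕ} (hp : p % 3 = 1) (hq : q % 3 = 0) (h : p ≤ q + 1) :
    HalfGraphRel p q := by
  unfold HalfGraphRel; omega

theorem HalfGraphRel.mod_of_ne_two {x y : ℕ} (h : HalfGraphRel x y) (hx : x % 3 ≠ 2)
    (hy : y % 3 ≠ 2) :
    (x % 3 = 1 ∧ y % 3 = 0 ∧ x ≤ y + 1) ∨ (y % 3 = 1 ∧ x % 3 = 0 ∧ y ≤ x + 1) := by
  unfold HalfGraphRel at h; omega

theorem HalfGraphRel.of_mod_eq_two {x y : ℕ} (h : HalfGraphRel x y) (hy : x % 3 = 2 ∨ y % 3 = 2) :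
    x + 1 = y ∨ y + 1 = x := by
  unfold HalfGraphRel at h; omega

/-- A vertex `≡ 2` has only its two path neighbors, and these are adjacent to each other, so it is
not the middle of an induced `P₃`. Nor can both ends be `≡ 2`, as they would differ by 2. Hence some
edge of the path joins residues `1` and `0`. -/
theorem HalfGraphRel.exists_edge {x y z : ℕ} (hxy : HalfGraphRel x y) (hyz : HalfGraphRel y z)
    (hne : x ≠ z) (hxz : ¬ HalfGraphRel x z) :
    ∃ p q, (p = x ∨ p = y ∨ p = z) ∧ (q = x ∨ q = y ∨ q = z) ∧ p % 3 = 1 ∧ q % 3 = 0 ∧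
      p ≤ q + 1 := by
  by_cases hy : y % 3 = 2
  · have h1 := hxy.of_mod_eq_two (.inr hy)
    have h2 := hyz.of_mod_eq_two (.inl hy)
    rcases h1 with h1 | h1
    · exact absurd (halfGraphRel_of_mod (p := x) (q := z) (by omega) (by omega) (by omega)) hxz
    · exact absurd (halfGraphRel_of_mod (p := z) (q := x) (by omega) (by omega) (by omega)).symm hxz
  by_cases hx : x % 3 = 2
  · by_cases hz : z % 3 = 2
    · have h1 := hxy.of_mod_eq_two (.inl hx)
      have h2 := hyz.of_mod_eq_two (.inr hz)
      omega
    · rcases hyz.mod_of_ne_two hy hz with h | h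
      · exact ⟨y, z, by simp, by simp, h⟩
      · exact ⟨z, y, by simp, by simp, h⟩
  · rcases hxy.mod_of_ne_two hx hy with h | h
    · exact ⟨x, y, by simp, by simp, h⟩
    · exact ⟨y, x, by simp, by simp, h⟩

/-- Take such an edge in each of two paths. If `p` is not adjacent to `q'`, then `p' ≤ q' + 1 < p ≤
q + 1`, so `p'` is adjacent to `q`. -/
theorem halfGraph_inducedFree {V : Type*} {n : ℕ} (e : V ≃ Fin n) :
    InducedFree twoPathThree (halfGraph e) := by
  by_contra h
  obtain ⟨x, y, z, x', y', z', hxy, hyz, hne, hxz, hxy', hyz', hne', hxz', h₁, h₂, h₃, h₄, h₅, h₆,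
    h₇, h₈, h₉⟩ := exists_paths_of_not_inducedFree h
  have hinj : ∀ {a b : V}, a ≠ b → (e a : ℕ) ≠ e b := fun hab h => hab (e.injective (Fin.ext h))
  obtain ⟨p, q, hp, hq, hp1, hq0, hpq⟩ := HalfGraphRel.exists_edge hxy hyz (hinj hne) hxz
  obtain ⟨p', q', hp', hq', hp1', hq0', hpq'⟩ :=
    HalfGraphRel.exists_edge hxy' hyz' (hinj hne') hxz'
  have key : ∀ a b, (a = (e x : ℕ) ∨ a = e y ∨ a = e z) → (b = (e x' : ℕ) ∨ b = e y' ∨ b = e z') →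
      ¬ HalfGraphRel a b := by
    rintro a b (rfl | rfl | rfl) (rfl | rfl | rfl) <;> assumption
  rcases le_or_gt p (q' + 1) with h | h
  · exact key p q' hp hq' (halfGraphRel_of_mod hp1 hq0' h)
  · exact key q p' hq hp' (halfGraphRel_of_mod hp1' hq0 (by omega)).symm

/-- From the left end, position `i` is forced to color `i % 3`, which at `3 * r - 2` is the only
color of the last vertex. Once `w` is deleted, the vertices before it take `i % 3` and those after
it `(i + 2) % 3`. A chord from residue `1` to a later residue `0` then sees the colors `1, 0` or `0,
2` or `1, 2`. -/
theorem halfGraph_isMinimalListObstruction {V : Type*} {r : ℕ} (hr : 0 < r)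
    (e : V ≃ Fin (3 * r)) :
    IsMinimalListObstruction (halfGraph e) (fun v => halfGraphList (3 * r) (e v)) := by
  constructor
  · rintro ⟨c, hc⟩
    have hforce : ∀ i (hi : i + 1 < 3 * r),
        (c (e.symm ⟨i, by omega⟩) : ℕ) = i % 3 := by
      intro i
      induction i with
      | zero =>
        intro hi
        have := hc (e.symm ⟨0, by omega⟩)
        simp only [halfGraphList, Finset.mem_filter, Equiv.apply_symm_apply] at this
        omega
      | succ i ih =>
        intro hi
        have h1 := hc (e.symm ⟨i + 1, by omega⟩)
        simp only [halfGraphList, Finset.mem_filter, Equiv.apply_symm_apply] at h1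
        have h2 := ih (by omega)
        have h3 : c (e.symm ⟨i, by omega⟩) ≠ c (e.symm ⟨i + 1, by omega⟩) := by
          apply c.valid
          simp [halfGraph, HalfGraphRel]
        have h4 := fun h => h3 (Fin.ext h)
        omega
    have h1 := hc (e.symm ⟨3 * r - 1, by omega⟩)
    simp only [halfGraphList, Finset.mem_filter, Equiv.apply_symm_apply] at h1
    have h2 := hforce (3 * r - 2) (by omega)
    have h3 : c (e.symm ⟨3 * r - 2, by omega⟩) ≠ c (e.symm ⟨3 * r - 1, by omega⟩) := by
      apply c.valid
      simp only [halfGraph, HalfGraphRel, Equiv.apply_symm_apply]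
      omega
    have h4 := fun h => h3 (Fin.ext h)
    omega
  · intro X hX
    obtain ⟨w, hw⟩ := (Set.ne_univ_iff_exists_notMem X).1 hX
    have hne : ∀ x : X, (e x : ℕ) ≠ e w := fun x h =>
      hw (e.injective (Fin.ext h) ▸ x.2)
    let f : X → Fin 3 := fun x => if (e x : ℕ) < e w
      then ⟨(e x : ℕ) % 3, Nat.mod_lt _ (by omega)⟩
      else ⟨((e x : ℕ) + 2) % 3, Nat.mod_lt _ (by omega)⟩
    have hf : ∀ x : X, f x ∈ halfGraphList (3 * r) (e x) := by
      intro x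
      have hx := hne x
      have := (e x).2
      have := (e w).2
      simp only [halfGraphList, Finset.mem_filter, f]
      refine ⟨Finset.mem_univ _, ?_⟩
      split_ifs
      · exact .inl ⟨rfl, by omega⟩
      · exact .inr ⟨rfl, by omega⟩
    refine ⟨SimpleGraph.Coloring.mk f ?_, hf⟩
    intro x y hxy h
    have hx := hne x
    have hy := hne y
    have hxy : HalfGraphRel (e x) (e y) := hxy
    unfold HalfGraphRel at hxy
    simp only [f] at h
    split_ifs at h <;> simp only [Fin.mk.injEq] at h <;> omega

/-! ### Periodic runs are short -/

section Run

variable {V : Type*} {G : SimpleGraph V} {A : Finset V} {T : ℕ} {v a : ℕ → V}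

/-- A path `v 0, …, v (T - 1)` whose further edges lead from some `i` to some `j ≡ i + 2 (mod 3)`,
`i + 2 ≤ j`, with vertices `a i ∈ A` whose neighbors on the path are congruent to `i` mod `3`. -/
structure IsPeriodicRun (G : SimpleGraph V) (A : Finset V) (T : ℕ) (v a : ℕ → V) : Prop where
  adj : ∀ i, i + 1 < T → G.Adj (v i) (v (i + 1))
  inj : ∀ i j, i < j → j < T → v i ≠ v j
  chord : ∀ i j, i + 2 ≤ j → j < T → G.Adj (v i) (v j) → j % 3 = (i + 2) % 3
  mem : ∀ i, i < T → a i ∈ A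
  adj_mem : ∀ i, i < T → G.Adj (a i) (v i)
  mod_eq : ∀ i j, i < T → j < T → G.Adj (a i) (v j) → i % 3 = j % 3

theorem IsPeriodicRun.not_adj (h : IsPeriodicRun G A T v a) {i j : ℕ} (hij : i + 2 ≤ j) (hj : j < T)
    (hm : j % 3 ≠ (i + 2) % 3) : ¬ G.Adj (v i) (v j) := fun hadj => hm (h.chord i j hij hj hadj)

/-- Two earlier vertices with the same neighbor in `A`: one of them is adjacent to `v x`. -/
theorem IsPeriodicRun.adj_or_adj (hG : InducedFree twoPathThree G) (h : IsPeriodicRun G A T v a)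
    {x t i k : ℕ} (hxt : x + 2 ≤ t) (ht : t < T) (hadj : G.Adj (v x) (v t)) (hik : i < k)
    (hkx : k + 2 < x) (hi : i % 3 = (x + 1) % 3) (hk : k % 3 = (x + 1) % 3) (ha : a i = a k) :
    G.Adj (v i) (v x) ∨ G.Adj (v k) (v x) := by
  by_contra! hno
  have htm := h.chord x t hxt ht hadj
  have hx : x - 1 + 1 = x := by omega
  have hxx : G.Adj (v (x - 1)) (v x) := by
    have := h.adj (x - 1) (by omega)
    rwa [hx] at this
  -- The residues exclude every edge between the two paths except those from `v i` and `v k` to `v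
  -- x`.
  refine hG.false_of_paths (x := v i) (y := a i) (z := v k) (x' := v (x - 1)) (y' := v x)
    (z' := v t) (h.adj_mem i (by omega)).symm (ha ▸ h.adj_mem k (by omega))
    (h.inj i k hik (by omega)) (h.not_adj (by omega) (by omega) (by omega)) hxx hadj
    (h.inj _ _ (by omega) ht) (h.not_adj (by omega) (by omega) (by omega))
    (h.not_adj (by omega) (by omega) (by omega)) hno.1
    (h.not_adj (by omega) (by omega) (by omega)) ?_ ?_ ?_
    (h.not_adj (by omega) (by omega) (by omega)) hno.2
    (h.not_adj (by omega) (by omega) (by omega))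
  all_goals
    intro hc
    have := h.mod_eq i _ (by omega) (by omega) hc
    omega

/-- If `v x` has a later chord, then it is adjacent to a vertex in every earlier long interval. -/
theorem IsPeriodicRun.exists_adj (hG : InducedFree twoPathThree G) (h : IsPeriodicRun G A T v a)
    {x t p : ℕ} (hxt : x + 2 ≤ t) (ht : t < T) (hadj : G.Adj (v x) (v t))
    (hp : p + (3 * A.card + 3) + 2 ≤ x) :
    ∃ i, p ≤ i ∧ i < p + (3 * A.card + 3) ∧ i % 3 = (x + 1) % 3 ∧ G.Adj (v i) (v x) := by
  by_contra! hno
  obtain ⟨s, hs, hsm⟩ : ∃ s, s < 3 ∧ (p + s) % 3 = (x + 1) % 3 :=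
    ⟨(x + 1 + 2 * p) % 3, by omega, by omega⟩
  -- The interval holds `A.card + 1` positions of the required residue, so two of them share their
  -- neighbor in `A`.
  have hcard : A.card < (Finset.range (A.card + 1)).card := by simp
  obtain ⟨i, hi, k, hk, hne, hik⟩ := Finset.exists_ne_map_eq_of_card_lt_of_maps_to hcard
    (f := fun i => a (p + s + 3 * i)) (fun i hi => h.mem _ (by
      have := Finset.mem_range.1 (Finset.mem_coe.1 hi); omega))
  rw [Finset.mem_range] at hi hk
  wlog hlt : i < k generalizing i k
  · exact this k hk i hi hne.symm hik.symm (by omega)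
  rcases h.adj_or_adj hG hxt ht hadj (i := p + s + 3 * i) (k := p + s + 3 * k) (by omega) (by omega)
    (by omega) (by omega) hik with h1 | h1
  · exact hno _ (by omega) (by omega) (by omega) h1
  · exact hno _ (by omega) (by omega) (by omega) h1

/-- A late chord at `x` produces chords back to `i`, `i'` and `l`, hence from `l` back to `k`, and
from `k` back to `j`, `j'`, each in its own block of length `M`. Each step back adds 1 to the
residue, so `j, k, j'` and `i, x, i'` have residues between which no chord is allowed. -/
theorem IsPeriodicRun.no_late_chord (hG : InducedFree twoPathThree G)
    (h : IsPeriodicRun G A T v a) {x t : ℕ} (hx : 6 * (3 * A.card + 6) ≤ x) (hxt : x + 2 ≤ t)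
    (ht : t < T) : ¬ G.Adj (v x) (v t) := by
  intro hadj
  set M := 3 * A.card + 6 with hM
  obtain ⟨l, hl1, hl2, hlm, hlx⟩ := h.exists_adj hG hxt ht hadj (p := 5 * M) (by omega)
  obtain ⟨i, hi1, hi2, him, hix⟩ := h.exists_adj hG hxt ht hadj (p := 2 * M) (by omega)
  obtain ⟨i', hi1', hi2', him', hix'⟩ := h.exists_adj hG hxt ht hadj (p := 3 * M) (by omega)
  obtain ⟨k, hk1, hk2, hkm, hkl⟩ :=
    h.exists_adj hG (by omega) (by omega : x < T) hlx (p := 4 * M) (by omega)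
  obtain ⟨j, hj1, hj2, hjm, hjk⟩ :=
    h.exists_adj hG (by omega) (by omega : l < T) hkl (p := 0) (by omega)
  obtain ⟨j', hj1', hj2', hjm', hjk'⟩ :=
    h.exists_adj hG (by omega) (by omega : l < T) hkl (p := M) (by omega)
  exact hG.false_of_paths (x := v j) (y := v k) (z := v j') (x' := v i) (y' := v x) (z' := v i')
    hjk hjk'.symm (h.inj _ _ (by omega) (by omega)) (h.not_adj (by omega) (by omega) (by omega))
    hix hix'.symm (h.inj _ _ (by omega) (by omega)) (h.not_adj (by omega) (by omega) (by omega))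
    (h.not_adj (by omega) (by omega) (by omega)) (h.not_adj (by omega) (by omega) (by omega))
    (h.not_adj (by omega) (by omega) (by omega))
    (mt G.adj_symm (h.not_adj (by omega) (by omega) (by omega)))
    (h.not_adj (by omega) (by omega) (by omega))
    (mt G.adj_symm (h.not_adj (by omega) (by omega) (by omega)))
    (h.not_adj (by omega) (by omega) (by omega)) (h.not_adj (by omega) (by omega) (by omega))
    (h.not_adj (by omega) (by omega) (by omega))

/-- Seven consecutive vertices beyond the reach of late chords form an induced `P₇`, which contains
`2P₃`. -/
theorem IsPeriodicRun.length_lt (hG : InducedFree twoPathThree G) (h : IsPeriodicRun G A T v a) :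
    T < 6 * (3 * A.card + 6) + 7 := by
  by_contra! hT
  set p := 6 * (3 * A.card + 6) with hp
  have hn : ∀ i j, i + 2 ≤ j → j < 7 → ¬ G.Adj (v (p + i)) (v (p + j)) := fun i j hij hj =>
    h.no_late_chord hG (by omega) (by omega) (by omega)
  exact hG.false_of_paths (h.adj p (by omega)) (h.adj (p + 1) (by omega))
    (h.inj _ _ (by omega) (by omega)) (hn 0 2 (by omega) (by omega))
    (h.adj (p + 4) (by omega)) (h.adj (p + 5) (by omega))
    (h.inj _ _ (by omega) (by omega)) (hn 4 6 (by omega) (by omega))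
    (hn 0 4 (by omega) (by omega)) (hn 0 5 (by omega) (by omega)) (hn 0 6 (by omega) (by omega))
    (hn 1 4 (by omega) (by omega)) (hn 1 5 (by omega) (by omega)) (hn 1 6 (by omega) (by omega))
    (hn 2 4 (by omega) (by omega)) (hn 2 5 (by omega) (by omega)) (hn 2 6 (by omega) (by omega))

end Run

/-! ### Forcing chains are short -/

section Chain

variable {V : Type*} {G : SimpleGraph V} {A : Finset V} {n : ℕ} {v a : ℕ → V} {m c d : ℕ → Fin 3}

/-- A path `v 0, …, v (n - 1)` along which colors propagate: the vertex `v i` has the list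
`{c i, d i}`, the color `d i = c (i - 1)` of its predecessor being the excluded one, and the color
`m i` missing from the list is that of a neighbor `a i ∈ A`. -/
structure IsForcingChain (G : SimpleGraph V) (A : Finset V) (n : ℕ) (v a : ℕ → V)
    (m c d : ℕ → Fin 3) : Prop where
  adj : ∀ i, i + 1 < n → G.Adj (v i) (v (i + 1))
  inj : ∀ i j, i < j → j < n → v i ≠ v j
  d_succ : ∀ i, i + 1 < n → d (i + 1) = c i
  ne : ∀ i, i < n → m i ≠ c i ∧ c i ≠ d i ∧ m i ≠ d i
  chord : ∀ i j, i + 2 ≤ j → j < n → G.Adj (v i) (v j) → m j = c i ∧ c j = d i ∧ d j = m i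
  mem : ∀ i, i < n → a i ∈ A
  adj_mem : ∀ i, i < n → G.Adj (a i) (v i)
  color_eq : ∀ i j, i < n → j < n → G.Adj (a i) (v j) → m i = m j

theorem fin_three_eq_third {x y z w : Fin 3} (hxy : x ≠ y) (hyz : y ≠ z) (hxz : x ≠ z)
    (hwx : w ≠ x) (hwy : w ≠ y) : w = z := by
  omega

/-- At two distant positions `i + 1` and `j`, the same list cannot be repeated at the next
position. -/
theorem IsForcingChain.not_two_stays (hG : InducedFree twoPathThree G)
    (h : IsForcingChain G A n v a m c d) {i j : ℕ} (hij : i + 4 ≤ j) (hj : j + 2 < n)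
    (hi' : m (i + 1 + 1) = m (i + 1)) (hj' : m (j + 1) = m j) (hm : m (i + 1) = m j)
    (hc : c (i + 1) = c j) : False := by
  have i0 := h.ne i (by omega)
  have i1 := h.ne (i + 1) (by omega)
  have i2 := h.ne (i + 1 + 1) (by omega)
  have j0 := h.ne j (by omega)
  have j1 := h.ne (j + 1) (by omega)
  have j2 := h.ne (j + 1 + 1) (by omega)
  have di1 := h.d_succ i (by omega)
  have di2 := h.d_succ (i + 1) (by omega)
  have dj1 := h.d_succ j (by omega)
  have dj2 := h.d_succ (j + 1) (by omega)
  have ci2 : c (i + 1 + 1) = d (i + 1) :=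
    fin_three_eq_third i1.1 i1.2.1 i1.2.2 (by grind) (by grind)
  have cj1 : c (j + 1) = d j := fin_three_eq_third j0.1 j0.2.1 j0.2.2 (by grind) (by grind)
  have hd : d (i + 1) = d j := fin_three_eq_third j0.1 j0.2.1 j0.2.2 (by grind) (by grind)
  -- A chord requires the triple `(m, c, d)` at its later end to be the rotation `(c, d, m)` of that
  -- at its earlier end; the repeated lists rule this out for all pairs involved.
  have hno : ∀ {p q}, p + 2 ≤ q → q < n → ¬ (m q = c p ∧ c q = d p ∧ d q = m p) →
      ¬ G.Adj (v p) (v q) := fun h1 h2 h3 h4 => h3 (h.chord _ _ h1 h2 h4)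
  exact hG.false_of_paths (h.adj i (by omega)) (h.adj (i + 1) (by omega))
    (h.inj _ _ (by omega) (by omega)) (hno (by omega) (by omega) (by grind))
    (h.adj j (by omega)) (h.adj (j + 1) (by omega))
    (h.inj _ _ (by omega) (by omega)) (hno (by omega) (by omega) (by grind))
    (hno (by omega) (by omega) (by grind)) (hno (by omega) (by omega) (by grind))
    (hno (by omega) (by omega) (by grind)) (hno (by omega) (by omega) (by grind))
    (hno (by omega) (by omega) (by grind)) (hno (by omega) (by omega) (by grind))
    (hno (by omega) (by omega) (by grind)) (hno (by omega) (by omega) (by grind))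
    (hno (by omega) (by omega) (by grind))

/-- A part of a forcing chain without two consecutive equal lists is a periodic run. -/
theorem IsForcingChain.isPeriodicRun (h : IsForcingChain G A n v a m c d) {p T : ℕ}
    (hp : p + T ≤ n) (hturn : ∀ i, i + 1 < T → m (p + i + 1) ≠ m (p + i)) :
    IsPeriodicRun G A T (fun i => v (p + i)) (fun i => a (p + i)) := by
  have hper : ∀ i, i < T →
      (i % 3 = 0 → m (p + i) = m p ∧ c (p + i) = c p ∧ d (p + i) = d p) ∧
      (i % 3 = 1 → m (p + i) = d p ∧ c (p + i) = m p ∧ d (p + i) = c p) ∧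
      (i % 3 = 2 → m (p + i) = c p ∧ c (p + i) = d p ∧ d (p + i) = m p) := by
    intro i
    induction i with
    | zero => intro _; simp
    | succ i ih =>
      intro hi
      have ih := ih (by omega)
      have h0 := h.ne (p + i) (by omega)
      have h1 := h.ne (p + i + 1) (by omega)
      have hd := h.d_succ (p + i) (by omega)
      have ht := hturn i hi
      -- Since the missing color changes, `(m, c, d)` turns into its rotation `(d, m, c)`, which has
      -- period 3.
      have hm : m (p + i + 1) = d (p + i) :=
        fin_three_eq_third h0.1 h0.2.1 h0.2.2 ht (hd ▸ h1.2.2)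
      have hc : c (p + i + 1) = m (p + i) :=
        fin_three_eq_third h0.2.1 h0.2.2.symm h0.1.symm (hd ▸ h1.2.1) (hm ▸ h1.1.symm)
      have h3 : i % 3 = 0 ∨ i % 3 = 1 ∨ i % 3 = 2 := by omega
      rw [← add_assoc, hm, hc, hd]
      rcases h3 with h3 | h3 | h3
      · have := ih.1 h3
        exact ⟨by omega, fun _ => ⟨this.2.2, this.1, this.2.1⟩, by omega⟩
      · have := ih.2.1 h3
        exact ⟨by omega, by omega, fun _ => ⟨this.2.2, this.1, this.2.1⟩⟩
      · have := ih.2.2 h3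
        exact ⟨fun _ => ⟨this.2.2, this.1, this.2.1⟩, by omega, by omega⟩
  refine ⟨fun i hi => h.adj _ (by omega), fun i j hij hj => h.inj _ _ (by omega) (by omega), ?_,
    fun i hi => h.mem _ (by omega), fun i hi => h.adj_mem _ (by omega), ?_⟩
  · intro i j hij hj hadj
    have hch := (h.chord _ _ (by omega) (by omega) hadj).1
    have hi := hper i (by omega)
    have hj := hper j (by omega)
    have h0 := h.ne p (by omega)
    have h3 : i % 3 = 0 ∨ i % 3 = 1 ∨ i % 3 = 2 := by omega
    have h4 : j % 3 = 0 ∨ j % 3 = 1 ∨ j % 3 = 2 := by omega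
    rcases h3 with h3 | h3 | h3 <;> rcases h4 with h4 | h4 | h4 <;> omega
  · intro i j hi hj hadj
    have hch := h.color_eq _ _ (by omega) (by omega) hadj
    have hi := hper i (by omega)
    have hj := hper j (by omega)
    have h0 := h.ne p (by omega)
    have h3 : i % 3 = 0 ∨ i % 3 = 1 ∨ i % 3 = 2 := by omega
    have h4 : j % 3 = 0 ∨ j % 3 = 1 ∨ j % 3 = 2 := by omega
    rcases h3 with h3 | h3 | h3 <;> rcases h4 with h4 | h4 | h4 <;> omega

/-- A bound for the length of forcing chains over a set `A` of `k` vertices. -/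
def forcingBound (k : ℕ) : ℕ := 10 * (6 * (3 * k + 6) + 10)

/-- Each of ten blocks is too long to be a periodic run, so it repeats a list. There are only nine
pairs `(m, c)`, so two of these repetitions agree. -/
theorem IsForcingChain.length_lt (hG : InducedFree twoPathThree G)
    (h : IsForcingChain G A n v a m c d) : n < forcingBound A.card := by
  by_contra! hn
  unfold forcingBound at hn
  obtain ⟨T, hT⟩ : ∃ T, T = 6 * (3 * A.card + 6) + 7 := ⟨_, rfl⟩
  have hn : 10 * (T + 3) ≤ n := by omega
  have hstay : ∀ k : Fin 10, ∃ i, k * (T + 3) ≤ i ∧ i + 2 < k * (T + 3) + T + 1 ∧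
      m (i + 1 + 1) = m (i + 1) := by
    intro k
    by_contra! hk
    have hk9 : (k : ℕ) * (T + 3) ≤ 9 * (T + 3) := Nat.mul_le_mul_right _ (by omega)
    have := (h.isPeriodicRun (p := k * (T + 3) + 1) (T := T) (by omega) fun i hi => by
      have := hk (k * (T + 3) + i) (by omega) (by omega)
      rwa [add_right_comm _ 1 i]).length_lt hG
    omega
  choose s hs1 hs2 hs3 using hstay
  obtain ⟨k, l, hkl, heq⟩ := Fintype.exists_ne_map_eq_of_card_lt
    (fun k : Fin 10 => (m (s k + 1), c (s k + 1))) (by simp)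
  wlog hlt : k < l generalizing k l
  · exact this l k hkl.symm heq.symm (lt_of_le_of_ne (not_lt.1 hlt) hkl.symm)
  have h1 : ((k : ℕ) + 1) * (T + 3) ≤ l * (T + 3) := Nat.mul_le_mul_right _ hlt
  have h2 : (l : ℕ) * (T + 3) ≤ 9 * (T + 3) := Nat.mul_le_mul_right _ (by omega)
  have hk1 := hs1 k
  have hk2 := hs2 k
  have hl1 := hs1 l
  have hl2 := hs2 l
  rw [add_mul] at h1
  exact h.not_two_stays hG (i := s k) (j := s l + 1) (by omega) (by omega) (hs3 k) (hs3 l)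
    (Prod.ext_iff.1 heq).1 (Prod.ext_iff.1 heq).2

end Chain

/-! ### Propagation in lists of size two -/

section TwoSat

variable {V : Type*} {G : SimpleGraph V} {L : V → Finset (Fin 3)}

/-- `f` is a proper coloring of the subgraph induced by `Y` with colors from the lists `L`. -/
def ProperOn (G : SimpleGraph V) (L : V → Finset (Fin 3)) (Y : Finset V) (f : V → Fin 3) : Prop :=
  (∀ v ∈ Y, f v ∈ L v) ∧ ∀ u ∈ Y, ∀ v ∈ Y, G.Adj u v → f u ≠ f v

theorem ProperOn.mono {Y Z : Finset V} {f : V → Fin 3} (h : ProperOn G L Z f) (hYZ : Y ⊆ Z) :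
    ProperOn G L Y f :=
  ⟨fun v hv => h.1 v (hYZ hv), fun u hu v hv => h.2 u (hYZ hu) v (hYZ hv)⟩

/-- Coloring `p.1` with `p.2` leaves only the color `q.2` for the neighbor `q.1` (if the list of
`q.1` has at most two elements). -/
def Forces (G : SimpleGraph V) (L : V → Finset (Fin 3)) (p q : V × Fin 3) : Prop :=
  G.Adj p.1 q.1 ∧ p.2 ∈ L q.1 ∧ q.2 ∈ L q.1 ∧ p.2 ≠ q.2

/-- The assignment `q` follows from `p` in exactly `n` propagation steps. -/
def ForcesIn (G : SimpleGraph V) (L : V → Finset (Fin 3)) : ℕ → V × Fin 3 → V × Fin 3 → Prop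
  | 0, p, q => p = q
  | n + 1, p, q => ∃ r, ForcesIn G L n p r ∧ Forces G L r q

theorem eq_of_card_le_two {S : Finset (Fin 3)} (hS : S.card ≤ 2) {x y z : Fin 3} (hx : x ∈ S)
    (hy : y ∈ S) (hz : z ∈ S) (hxy : x ≠ y) (hzx : z ≠ x) : z = y := by
  by_contra hzy
  have : ({x, y, z} : Finset (Fin 3)).card ≤ S.card :=
    Finset.card_le_card (by simp [Finset.insert_subset_iff, hx, hy, hz])
  rw [Finset.card_eq_three.2 ⟨x, y, z, hxy, hzx.symm, Ne.symm hzy, rfl⟩] at this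
  omega

theorem Forces.eq (hL : ∀ v, (L v).card ≤ 2) {p q : V × Fin 3} (h : Forces G L p q) {Y : Finset V}
    {f : V → Fin 3} (hf : ProperOn G L Y f) (hp : p.1 ∈ Y) (hq : q.1 ∈ Y) (hfp : f p.1 = p.2) :
    f q.1 = q.2 :=
  eq_of_card_le_two (hL q.1) h.2.1 h.2.2.1 (hf.1 _ hq) h.2.2.2
    fun h' => hf.2 _ hp _ hq h.1 (hfp.trans h'.symm)

theorem ForcesIn.exists_finset (hL : ∀ v, (L v).card ≤ 2) {n : ℕ} {p q : V × Fin 3}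
    (h : ForcesIn G L n p q) : ∃ Y : Finset V, Y.card ≤ n + 1 ∧ p.1 ∈ Y ∧ q.1 ∈ Y ∧
      ∀ f, ProperOn G L Y f → f p.1 = p.2 → f q.1 = q.2 := by
  classical
  induction n generalizing q with
  | zero =>
    obtain rfl : p = q := h
    exact ⟨{p.1}, by simp⟩
  | succ n ih =>
    obtain ⟨r, hr, hrq⟩ := h
    obtain ⟨Y, hY, hp, hrY, hf⟩ := ih hr
    refine ⟨insert q.1 Y, (Finset.card_insert_le _ _).trans (by omega),
      Finset.mem_insert_of_mem hp, Finset.mem_insert_self _ _, fun f hfY hfp => ?_⟩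
    exact hrq.eq hL hfY (Finset.mem_insert_of_mem hrY) (Finset.mem_insert_self _ _)
      (hf f (hfY.mono (Finset.subset_insert _ _)) hfp)

/-- Propagating the color `a` of `v` leads to a contradiction. -/
def Conflict (G : SimpleGraph V) (L : V → Finset (Fin 3)) (v : V) (a : Fin 3) : Prop :=
  (∃ p q i j, ForcesIn G L i (v, a) p ∧ ForcesIn G L j (v, a) q ∧
    G.Adj p.1 q.1 ∧ p.2 = q.2) ∨
  ∃ p i y, ForcesIn G L i (v, a) p ∧ G.Adj p.1 y ∧ L y ⊆ {p.2}

/-- Choose `v` in a minimal uncolorable set. If propagation from `v` met no conflict, the forced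
colors could be combined with a coloring of the unreached vertices: an unreached vertex sharing the
color of a reached neighbor would itself have been reached. -/
theorem exists_conflict [Fintype V] (h : ¬ ∃ f, ProperOn G L Finset.univ f) :
    ∃ v, ∀ a ∈ L v, Conflict G L v a := by
  classical
  obtain ⟨U, hU, hmin⟩ : ∃ U : Finset V, (¬ ∃ f, ProperOn G L U f) ∧
      ∀ U' ⊂ U, ∃ f, ProperOn G L U' f := by
    obtain ⟨U, hU⟩ := exists_minimal_of_wellFoundedLT (fun U : Finset V => ¬ ∃ f, ProperOn G L U f)
      ⟨_, h⟩
    exact ⟨U, hU.1, fun U' hU' => by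
      by_contra h'
      exact hU'.2 (hU.2 h' hU'.1)⟩
  obtain ⟨v, hv⟩ : U.Nonempty := by
    rw [Finset.nonempty_iff_ne_empty]
    rintro rfl
    exact hU ⟨fun _ => 0, by simp [ProperOn]⟩
  refine ⟨v, fun a ha => ?_⟩
  by_contra hconf
  simp only [Conflict, not_or, not_exists, not_and] at hconf
  obtain ⟨hc1, hc2⟩ := hconf
  let S : Set (V × Fin 3) := {p | ∃ i, ForcesIn G L i (v, a) p}
  have hprop : ∀ p ∈ S, ∀ q ∈ S, G.Adj p.1 q.1 → p.2 ≠ q.2 := by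
    rintro p ⟨i, hi⟩ q ⟨j, hj⟩ h
    exact hc1 p q i j hi hj h
  have hmem : ∀ p ∈ S, p.2 ∈ L p.1 := by
    rintro p ⟨i | i, hi⟩
    · obtain rfl : (v, a) = p := hi
      exact ha
    · obtain ⟨r, _, hr⟩ := hi
      exact hr.2.2.1
  let U' := U.filter fun u => ¬ ∃ c, (u, c) ∈ S
  have hvS : (v, a) ∈ S := ⟨0, rfl⟩
  obtain ⟨f, hf⟩ := hmin U' ⟨Finset.filter_subset _ _, fun hs => by
    have := (Finset.mem_filter.1 (hs hv)).2
    exact this ⟨a, hvS⟩⟩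
  let g : V → Fin 3 := fun u => if h : ∃ c, (u, c) ∈ S then h.choose else f u
  have hg1 : ∀ u, (∃ c, (u, c) ∈ S) → (u, g u) ∈ S := fun u hu => by
    simp only [g, dif_pos hu]; exact hu.choose_spec
  have hg2 : ∀ u, (¬ ∃ c, (u, c) ∈ S) → g u = f u := fun u hu => by simp only [g, dif_neg hu]
  have hcross : ∀ x ∈ U, ∀ y ∈ U, G.Adj x y → (∃ c, (x, c) ∈ S) → (¬ ∃ c, (y, c) ∈ S) →
      g x ≠ g y := by
    intro x hx y hy hxy hxS hyS heq
    have hxS' := hg1 x hxS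
    have hyU : y ∈ U' := Finset.mem_filter.2 ⟨hy, hyS⟩
    have hyL := hf.1 y hyU
    rw [← hg2 y hyS, ← heq] at hyL
    obtain ⟨i, hi⟩ := hxS'
    have := hc2 _ i y hi hxy
    obtain ⟨c, hc, hcx⟩ := Finset.not_subset.1 this
    exact hyS ⟨c, i + 1, _, hi, hxy, hyL, hc, fun h => hcx (Finset.mem_singleton.2 h.symm)⟩
  refine hU ⟨g, fun u hu => ?_, fun x hx y hy hxy => ?_⟩
  · by_cases hS : ∃ c, (u, c) ∈ S
    · exact hmem _ (hg1 u hS)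
    · rw [hg2 u hS]
      exact hf.1 u (Finset.mem_filter.2 ⟨hu, hS⟩)
  · by_cases hxS : ∃ c, (x, c) ∈ S <;> by_cases hyS : ∃ c, (y, c) ∈ S
    · exact hprop _ (hg1 x hxS) _ (hg1 y hyS) hxy
    · exact hcross x hx y hy hxy hxS hyS
    · exact (hcross y hy x hx hxy.symm hyS hxS).symm
    · rw [hg2 x hxS, hg2 y hyS]
      exact hf.2 x (Finset.mem_filter.2 ⟨hx, hxS⟩) y (Finset.mem_filter.2 ⟨hy, hyS⟩) hxy

/-- If propagation takes at most `N` steps, then an uncolorable instance with lists of size at most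
two has an uncolorable subset of bounded size. -/
theorem exists_small_not_properOn [Fintype V] (hL : ∀ v, (L v).card ≤ 2) {N : ℕ}
    (hN : ∀ v a p i, a ∈ L v → ForcesIn G L i (v, a) p → ∃ j ≤ N, ForcesIn G L j (v, a) p)
    (h : ¬ ∃ f, ProperOn G L Finset.univ f) :
    ∃ Y : Finset V, Y.card ≤ 3 * (2 * N + 3) + 1 ∧ ∀ f, ¬ ProperOn G L Y f := by
  classical
  obtain ⟨v, hv⟩ := exists_conflict h
  have key : ∀ a : Fin 3, ∃ Y : Finset V, Y.card ≤ 2 * N + 3 ∧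
      (a ∈ L v → ∀ f, ProperOn G L Y f → f v ≠ a) := by
    intro a
    by_cases ha : a ∈ L v
    swap
    · exact ⟨∅, by simp, fun h => absurd h ha⟩
    rcases hv a ha with ⟨p, q, i, j, hi, hj, h3, h4⟩ | ⟨p, i, y, hi, hpy, hy⟩
    · obtain ⟨i', hi', hi⟩ := hN _ _ _ _ ha hi
      obtain ⟨j', hj', hj⟩ := hN _ _ _ _ ha hj
      obtain ⟨Y, hYc, hvY, hpY, hY⟩ := hi.exists_finset hL
      obtain ⟨Z, hZc, hvZ, hqZ, hZ⟩ := hj.exists_finset hL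
      refine ⟨Y ∪ Z, (Finset.card_union_le _ _).trans (by omega), fun _ f hf hfv => ?_⟩
      have h1 := hY f (hf.mono Finset.subset_union_left) hfv
      have h2 := hZ f (hf.mono Finset.subset_union_right) hfv
      exact hf.2 _ (Finset.mem_union_left _ hpY) _ (Finset.mem_union_right _ hqZ) h3
        (by rw [h1, h2, h4])
    · obtain ⟨i', hi', hi⟩ := hN _ _ _ _ ha hi
      obtain ⟨Y, hYc, hvY, hpY, hY⟩ := hi.exists_finset hL
      refine ⟨insert y Y, (Finset.card_insert_le _ _).trans (by omega), fun _ f hf hfv => ?_⟩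
      have h1 := hY f (hf.mono (Finset.subset_insert _ _)) hfv
      have h2 := Finset.mem_singleton.1 (hy (hf.1 y (Finset.mem_insert_self _ _)))
      exact hf.2 _ (Finset.mem_insert_of_mem hpY) _ (Finset.mem_insert_self _ _) hpy
        (by rw [h1, h2])
  choose Y hYc hY using key
  refine ⟨insert v (Finset.univ.biUnion Y), (Finset.card_insert_le _ _).trans ?_, fun f hf => ?_⟩
  · have := Finset.card_biUnion_le_card_mul Finset.univ Y (2 * N + 3) fun a _ => hYc a
    simpa using this
  · refine hY (f v) (hf.1 v (Finset.mem_insert_self _ _)) f (hf.mono ?_) rfl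
    exact (Finset.subset_biUnion_of_mem Y (Finset.mem_univ _)).trans (Finset.subset_insert _ _)

/-- The assignment of `a` to `v` extends to every set of at most `K` vertices. -/
def LocallyConsistent (G : SimpleGraph V) (L : V → Finset (Fin 3)) (K : ℕ) (v : V) (a : Fin 3) :
    Prop :=
  ∀ X : Finset V, v ∈ X → X.card ≤ K → ∃ f, ProperOn G L X f ∧ f v = a

open Classical in
/-- The locally consistent colors of `v`. -/
noncomputable def consistentList (G : SimpleGraph V) (L : V → Finset (Fin 3)) (K : ℕ) (v : V) :
    Finset (Fin 3) :=
  (L v).filter (LocallyConsistent G L K v)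

theorem consistentList_subset (K : ℕ) (v : V) : consistentList G L K v ⊆ L v := by
  simp [consistentList]

theorem exists_properOn_of_mem_consistentList {K : ℕ} {v : V} {a : Fin 3}
    (h : a ∈ consistentList G L K v) {X : Finset V} (hv : v ∈ X) (hX : X.card ≤ K) :
    ∃ f, ProperOn G L X f ∧ f v = a := by
  simp only [consistentList, Finset.mem_filter] at h
  exact h.2 X hv hX

/-- Each deleted color of each vertex of `Y` has a refuting set of at most `K` vertices; adding
these sets to `Y` makes the deletions unnecessary. -/
theorem exists_not_properOn_of_consistentList {K : ℕ} {Y : Finset V}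
    (hY : ∀ f, ¬ ProperOn G (consistentList G L K) Y f) :
    ∃ Z : Finset V, Z.card ≤ Y.card + Y.card * (3 * K) ∧ ∀ f, ¬ ProperOn G L Z f := by
  classical
  have key : ∀ (v : V) (a : Fin 3), ∃ X : Finset V, X.card ≤ K ∧
      (a ∈ L v → a ∉ consistentList G L K v → ∀ f, ProperOn G L X f → f v ≠ a) := by
    intro v a
    by_cases h : a ∈ L v ∧ a ∉ consistentList G L K v
    · obtain ⟨h1, h2⟩ := h
      simp only [consistentList, LocallyConsistent, Finset.mem_filter, not_and, not_forall] at h2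
      obtain ⟨X, _, hX, hf⟩ := h2 h1
      exact ⟨X, hX, fun _ _ f hfX hfa => hf ⟨f, hfX, hfa⟩⟩
    · exact ⟨∅, by simp, fun h1 h2 => absurd ⟨h1, h2⟩ h⟩
  choose X hXc hX using key
  refine ⟨Y ∪ Y.biUnion fun v => Finset.univ.biUnion (X v), ?_, fun f hf => ?_⟩
  · refine (Finset.card_union_le _ _).trans (Nat.add_le_add_left ?_ _)
    refine Finset.card_biUnion_le_card_mul _ _ _ fun v _ => ?_
    have := Finset.card_biUnion_le_card_mul Finset.univ (X v) K fun a _ => hXc v a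
    simpa using this
  · refine hY f ⟨fun v hv => ?_, (hf.mono Finset.subset_union_left).2⟩
    by_contra hc
    refine hX v (f v) (hf.1 v (Finset.mem_union_left _ hv)) hc f (hf.mono ?_) rfl
    refine Finset.Subset.trans ?_ Finset.subset_union_right
    exact (Finset.subset_biUnion_of_mem (X v) (Finset.mem_univ _)).trans
      (Finset.subset_biUnion_of_mem (fun v => Finset.univ.biUnion (X v)) hv)

/-- Along a shortest propagation sequence the distances from the start are `0, 1, …, n`. -/
theorem exists_shortest_seq {p q : V × Fin 3} {n : ℕ} (h : ForcesIn G L n p q)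
    (hmin : ∀ j < n, ¬ ForcesIn G L j p q) : ∃ s : ℕ → V × Fin 3, s n = q ∧
      (∀ i < n, Forces G L (s i) (s (i + 1))) ∧
      (∀ i ≤ n, ForcesIn G L i p (s i)) ∧ ∀ i ≤ n, ∀ j < i, ¬ ForcesIn G L j p (s i) := by
  induction n generalizing q with
  | zero => exact ⟨fun _ => q, rfl, by simp, by simpa using h, by simp⟩
  | succ n ih =>
    obtain ⟨r, hr, hrq⟩ := id h
    obtain ⟨s, hs0, hs1, hs2, hs3⟩ := ih hr fun j hj hjr => hmin (j + 1) (by omega) ⟨r, hjr, hrq⟩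
    have hlast : Function.update s (n + 1) q (n + 1) = q := by simp
    have hlt : ∀ i ≤ n, Function.update s (n + 1) q i = s i := fun i hi => by
      simp [Function.update_of_ne (show i ≠ n + 1 by omega)]
    refine ⟨Function.update s (n + 1) q, hlast, fun i hi => ?_, fun i hi => ?_, fun i hi => ?_⟩
    · rcases (show i < n ∨ i = n by omega) with h | rfl
      · rw [hlt i (by omega), hlt (i + 1) (by omega)]
        exact hs1 i h
      · rw [hlt i le_rfl, hlast, hs0]
        exact hrq
    · rcases Nat.le_succ_iff.1 hi with h' | rfl
      · rw [hlt i h']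
        exact hs2 i h'
      · rwa [hlast]
    · rcases Nat.le_succ_iff.1 hi with h' | rfl
      · rw [hlt i h']
        exact hs3 i h'
      · rwa [hlast]

end TwoSat

/-! ### Extending colorings of a dominating set -/

section Dominating

variable {V : Type*} {G : SimpleGraph V}

/-- The lists after coloring `A` by `χ`: vertices of `A` keep only their color, the other vertices
lose the colors of their neighbors in `A`. -/
noncomputable def colorLists (G : SimpleGraph V) (A : Finset V) (χ : V → Fin 3) (v : V) :
    Finset (Fin 3) :=
  open Classical in
  Finset.univ.filter fun c => ∀ u ∈ A, (u = v → c = χ u) ∧ (G.Adj u v → c ≠ χ u)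

theorem mem_colorLists {A : Finset V} {χ : V → Fin 3} {v : V} {c : Fin 3} :
    c ∈ colorLists G A χ v ↔ ∀ u ∈ A, (u = v → c = χ u) ∧ (G.Adj u v → c ≠ χ u) := by
  simp [colorLists]

theorem card_colorLists_le {A : Finset V} (hA : ∀ v, v ∈ A ∨ ∃ u ∈ A, G.Adj u v) (χ : V → Fin 3)
    (v : V) : (colorLists G A χ v).card ≤ 2 := by
  rcases hA v with hv | ⟨u, hu, huv⟩
  · have : colorLists G A χ v ⊆ {χ v} := fun c hc =>
      Finset.mem_singleton.2 ((mem_colorLists.1 hc v hv).1 rfl)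
    exact (Finset.card_le_card this).trans (by simp)
  · have : colorLists G A χ v ⊆ Finset.univ.erase (χ u) := fun c hc =>
      Finset.mem_erase.2 ⟨(mem_colorLists.1 hc u hu).2 huv, Finset.mem_univ _⟩
    exact (Finset.card_le_card this).trans (by simp)

/-- Propagation in the locally consistent lists takes a bounded number of steps. -/
theorem forcesIn_bounded (hG : InducedFree twoPathThree G) {A : Finset V}
    (hA : ∀ v, v ∈ A ∨ ∃ u ∈ A, G.Adj u v) {χ : V → Fin 3} {K n : ℕ}
    (hK : forcingBound A.card + 1 ≤ K) {p q : V × Fin 3}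
    (h : ForcesIn G (consistentList G (colorLists G A χ) K) n p q)
    (hmin : ∀ j < n, ¬ ForcesIn G (consistentList G (colorLists G A χ) K) j p q) :
    n ≤ forcingBound A.card := by
  classical
  set L := colorLists G A χ
  have hL : ∀ v, (L v).card ≤ 2 := card_colorLists_le hA χ
  obtain ⟨N, hN⟩ : ∃ N, N = forcingBound A.card := ⟨_, rfl⟩
  by_contra! hn
  obtain ⟨s, -, hs1, hs2, hs3⟩ := exists_shortest_seq h hmin
  have hF : ∀ i ≤ N, G.Adj (s i).1 (s (i + 1)).1 ∧
      (s i).2 ∈ consistentList G L K (s (i + 1)).1 ∧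
      (s (i + 1)).2 ∈ consistentList G L K (s (i + 1)).1 ∧ (s i).2 ≠ (s (i + 1)).2 :=
    fun i hi => hs1 i (by omega)
  have hFL : ∀ i ≤ N, Forces G L (s i) (s (i + 1)) := fun i hi =>
    ⟨(hF i hi).1, consistentList_subset _ _ (hF i hi).2.1, consistentList_subset _ _ (hF i hi).2.2.1,
      (hF i hi).2.2.2⟩
  have hNpos : 0 < N := by rw [hN]; unfold forcingBound; omega
  let X : Finset V := (Finset.range (N + 1)).image fun i => (s (i + 1)).1
  have hX : X.card ≤ K := Finset.card_image_le.trans (by simp; omega)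
  have hmemX : ∀ i ≤ N, (s (i + 1)).1 ∈ X := fun i hi =>
    Finset.mem_image.2 ⟨i, Finset.mem_range.2 (by omega), rfl⟩
  -- `f` starts with the forced color and follows the sequence forwards. `g` gives the last vertex
  -- its other color and so, read backwards, gives every vertex the color excluded there.
  obtain ⟨f, hf, hf0⟩ := exists_properOn_of_mem_consistentList (hF 0 (by omega)).2.2.1
    (hmemX 0 (by omega)) hX
  obtain ⟨g, hg, hg0⟩ := exists_properOn_of_mem_consistentList (hF N le_rfl).2.1
    (hmemX N le_rfl) hX
  have hf' : ∀ i ≤ N, f (s (i + 1)).1 = (s (i + 1)).2 := by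
    intro i
    induction i with
    | zero => intro _; exact hf0
    | succ i ih =>
      intro hi
      exact (hFL (i + 1) hi).eq hL hf (hmemX i (by omega)) (hmemX (i + 1) hi) (ih (by omega))
  have hg' : ∀ k ≤ N, g (s (N - k + 1)).1 = (s (N - k)).2 := by
    intro k
    induction k with
    | zero => intro _; exact hg0
    | succ k ih =>
      intro hk
      have ih := ih (by omega)
      obtain ⟨j, hj⟩ : ∃ j, N - k = j + 1 := ⟨N - k - 1, by omega⟩
      have hj' : N - (k + 1) = j := by omega
      rw [hj] at ih
      rw [hj']
      have h1 := hFL j (by omega)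
      refine eq_of_card_le_two (hL _) h1.2.2.1 h1.2.1 (hg.1 _ (hmemX j (by omega))) h1.2.2.2.symm ?_
      have := hg.2 _ (hmemX j (by omega)) _ (hmemX (j + 1) (by omega)) (hFL (j + 1) (by omega)).1
      rwa [ih] at this
  have hg'' : ∀ i ≤ N, g (s (i + 1)).1 = (s i).2 := by
    intro i hi
    have := hg' (N - i) (by omega)
    rwa [show N - (N - i) = i by omega] at this
  -- A vertex of `A` has a single color left, while each vertex reached by a step has two.
  have hnotA : ∀ i ≤ N, ∃ u ∈ A, G.Adj u (s (i + 1)).1 := by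
    intro i hi
    refine (hA _).resolve_left fun hmem => ?_
    have h1 := hFL i hi
    exact h1.2.2.2 (((mem_colorLists.1 h1.2.1 _ hmem).1 rfl).trans
      ((mem_colorLists.1 h1.2.2.1 _ hmem).1 rfl).symm)
  have : Nonempty V := ⟨p.1⟩
  choose! a haA haadj using hnotA
  have hcol : ∀ i ≤ N, ∀ u ∈ A, G.Adj u (s (i + 1)).1 →
      χ u ≠ (s (i + 1)).2 ∧ χ u ≠ (s i).2 := fun i hi u hu hadj =>
    ⟨((mem_colorLists.1 (hFL i hi).2.2.1 u hu).2 hadj).symm,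
      ((mem_colorLists.1 (hFL i hi).2.1 u hu).2 hadj).symm⟩
  have hchain : IsForcingChain G A N (fun i => (s (i + 1)).1) a (fun i => χ (a i))
      (fun i => (s (i + 1)).2) (fun i => (s i).2) := by
    refine ⟨fun i hi => (hF (i + 1) (by omega)).1, fun i j hij hj heq => ?_, fun i _ => rfl,
      fun i hi => ?_, fun i j hij hj hadj => ?_, fun i hi => haA i hi.le,
      fun i hi => haadj i hi.le, fun i j hi hj hadj => ?_⟩
    · have h1 : s (i + 1) = s (j + 1) := by
        refine Prod.ext heq ?_
        rw [← hf' i (by omega), ← hf' j (by omega)]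
        exact congrArg f heq
      exact hs3 (j + 1) (by omega) (i + 1) (by omega) (h1 ▸ hs2 (i + 1) (by omega))
    · have h1 := hcol i hi.le _ (haA i hi.le) (haadj i hi.le)
      exact ⟨h1.1, (hF i hi.le).2.2.2.symm, h1.2⟩
    · have hi1 := hcol i (by omega) _ (haA i (by omega)) (haadj i (by omega))
      have hj1 := hcol j (by omega) _ (haA j (by omega)) (haadj j (by omega))
      have hi2 := (hF i (by omega)).2.2.2
      have hj2 := (hF j (by omega)).2.2.2
      have h1 := hf.2 _ (hmemX i (by omega)) _ (hmemX j (by omega)) hadj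
      have h2 := hg.2 _ (hmemX i (by omega)) _ (hmemX j (by omega)) hadj
      rw [hf' i (by omega), hf' j (by omega)] at h1
      rw [hg'' i (by omega), hg'' j (by omega)] at h2
      -- Otherwise the chord would be a shortcut to `s (j + 1)`. With `h1` from `f` and `h2` from
      -- `g`, this determines the cyclic pattern.
      have h3 : (s (i + 1)).2 ≠ (s j).2 := by
        intro h3
        refine hs3 (j + 1) (by omega) (i + 2) (by omega) ⟨s (i + 1), hs2 _ (by omega), hadj, ?_,
          (hF j (by omega)).2.2.1, h1⟩
        rw [h3]
        exact (hF j (by omega)).2.1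
      refine ⟨?_, ?_, ?_⟩ <;> omega
    · have h1 := hcol i hi.le _ (haA i hi.le) (haadj i hi.le)
      have h2 := hcol j hj.le _ (haA i hi.le) hadj
      have h3 := hcol j hj.le _ (haA j hj.le) (haadj j hj.le)
      have h4 := (hF j hj.le).2.2.2
      omega
  exact absurd (hchain.length_lt hG) (by omega)

/-- A bound for the number of vertices that witness that a coloring of a dominating set of `k`
vertices does not extend. -/
def witnessBound (k : ℕ) : ℕ :=
  (3 * (2 * forcingBound k + 3) + 1) * (1 + 3 * (forcingBound k + 1))

theorem exists_witness [Fintype V] (hG : InducedFree twoPathThree G) {A : Finset V}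
    (hA : ∀ v, v ∈ A ∨ ∃ u ∈ A, G.Adj u v) (χ : V → Fin 3)
    (h : ¬ ∃ f, ProperOn G (colorLists G A χ) Finset.univ f) :
    ∃ Y : Finset V, Y.card ≤ witnessBound A.card ∧ ∀ f, ¬ ProperOn G (colorLists G A χ) Y f := by
  classical
  set L := colorLists G A χ
  set K := forcingBound A.card + 1 with hK
  obtain ⟨Y, hY, hYf⟩ := exists_small_not_properOn (G := G) (L := consistentList G L K)
    (fun v => (Finset.card_le_card (consistentList_subset K v)).trans (card_colorLists_le hA χ v))
    (N := forcingBound A.card) (fun v a p i _ hi => by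
      have hex : ∃ j, ForcesIn G (consistentList G L K) j (v, a) p := ⟨i, hi⟩
      exact ⟨Nat.find hex, forcesIn_bounded hG hA hK.ge (Nat.find_spec hex)
        fun j hj => Nat.find_min hex hj, Nat.find_spec hex⟩)
    (fun ⟨f, hf⟩ => h ⟨f, fun v hv => consistentList_subset K v (hf.1 v hv), hf.2⟩)
  obtain ⟨Z, hZ, hZf⟩ := exists_not_properOn_of_consistentList hYf
  refine ⟨Z, hZ.trans ?_, hZf⟩
  calc Y.card + Y.card * (3 * K) = Y.card * (1 + 3 * K) := by ring
    _ ≤ _ := Nat.mul_le_mul_right _ hY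

/-- An uncolorable `2P₃`-free graph with a dominating set of at most `k` vertices has an uncolorable
induced subgraph of bounded size. -/
theorem exists_small_not_colorable [Fintype V] (hG : InducedFree twoPathThree G) {A : Finset V}
    (hA : ∀ v, v ∈ A ∨ ∃ u ∈ A, G.Adj u v) (h : ¬ G.Colorable 3) :
    ∃ Y : Finset V, Y.card ≤ A.card + 3 ^ A.card * witnessBound A.card ∧
      ¬ (G.induce (Y : Set V)).Colorable 3 := by
  classical
  have hext : ∀ ψ : A → Fin 3, ∃ χ : V → Fin 3, ∀ u : A, χ u = ψ u := fun ψ =>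
    ⟨fun v => if hv : v ∈ A then ψ ⟨v, hv⟩ else 0, fun u => by simp⟩
  choose χ hχ using hext
  have hno : ∀ ψ : A → Fin 3, ¬ ∃ f, ProperOn G (colorLists G A (χ ψ)) Finset.univ f :=
    fun ψ ⟨f, hf⟩ => h ⟨SimpleGraph.Coloring.mk f fun {u v} huv =>
      hf.2 u (Finset.mem_univ _) v (Finset.mem_univ _) huv⟩
  choose Y hY hYf using fun ψ => exists_witness hG hA (χ ψ) (hno ψ)
  refine ⟨A ∪ Finset.univ.biUnion Y, (Finset.card_union_le _ _).trans
    (Nat.add_le_add_left ?_ _), ?_⟩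
  · have := Finset.card_biUnion_le_card_mul Finset.univ Y _ fun ψ _ => hY ψ
    simpa using this
  · rintro ⟨c⟩
    let f : V → Fin 3 := fun v =>
      if hv : v ∈ ((A ∪ Finset.univ.biUnion Y : Finset V) : Set V) then c ⟨v, hv⟩ else 0
    have hf : ∀ u ∈ A ∪ Finset.univ.biUnion Y, ∀ v ∈ A ∪ Finset.univ.biUnion Y,
        G.Adj u v → f u ≠ f v := by
      intro u hu v hv huv
      simp only [f, dif_pos (Finset.mem_coe.2 hu), dif_pos (Finset.mem_coe.2 hv)]
      exact c.valid (by simpa using huv)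
    let ψ : A → Fin 3 := fun u => f u
    have hsub : Y ψ ⊆ A ∪ Finset.univ.biUnion Y :=
      (Finset.subset_biUnion_of_mem Y (Finset.mem_univ ψ)).trans Finset.subset_union_right
    refine hYf ψ f ⟨fun v hv => mem_colorLists.2 fun u hu => ?_,
      fun u hu v hv => hf u (hsub hu) v (hsub hv)⟩
    rw [hχ ψ ⟨u, hu⟩]
    exact ⟨fun huv => by simp [ψ, huv], fun huv =>
      (hf u (Finset.mem_union_left _ hu) v (hsub hv) huv).symm⟩

end Dominating

/-! ### Greedy covering by almost nested sets -/

section Greedy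

variable {V : Type*} {G : SimpleGraph V}

/-- If the sets `S y` of nonadjacent vertices are nested up to one element, then few of them cover
each of the others up to one element. -/
theorem exists_greedy_cover [DecidableEq V] {S : V → Finset V}
    (hS : ∀ y z, ¬ G.Adj y z → (S y \ S z).card ≤ 1 ∨ (S z \ S y).card ≤ 1) (k : ℕ) :
    ∀ Z T : Finset V, (∀ Q ⊆ Z, ¬ G.IsNClique k Q) →
      ∃ P : Finset V, P.card ≤ k ∧ ∀ z ∈ Z, (S z \ (T ∪ P.biUnion S)).card ≤ 1 := by
  classical
  induction k with
  | zero => exact fun Z T h => absurd (by simp) (h ∅ (Finset.empty_subset _))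
  | succ k ih =>
    intro Z T hZ
    rcases Z.eq_empty_or_nonempty with rfl | hne
    · exact ⟨∅, by simp⟩
    -- A largest `S y` covers the sets of all non-neighbors of `y` up to one element; the neighbors
    -- of `y` span smaller cliques, which allows induction.
    obtain ⟨y, hy, hmax⟩ := Z.exists_max_image (fun y => (S y \ T).card) hne
    obtain ⟨P, hP, hcov⟩ := ih (Z.filter fun z => G.Adj y z) (T ∪ S y) fun Q hQ hclique =>
      hZ (insert y Q) (Finset.insert_subset hy (hQ.trans (Finset.filter_subset _ _)))
        (hclique.insert fun z hz => (Finset.mem_filter.1 (hQ hz)).2)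
    refine ⟨insert y P, (Finset.card_insert_le _ _).trans (by omega), fun z hz => ?_⟩
    rw [Finset.biUnion_insert, ← Finset.union_assoc]
    by_cases hyz : G.Adj y z
    · exact hcov z (Finset.mem_filter.2 ⟨hz, hyz⟩)
    · refine (Finset.card_le_card (Finset.sdiff_subset_sdiff le_rfl
        Finset.subset_union_left)).trans ?_
      have h1 : S z \ (T ∪ S y) ⊆ S z \ S y :=
        Finset.sdiff_subset_sdiff le_rfl Finset.subset_union_right
      rcases hS y z hyz with h | h
      · have h2 : ((S z \ T) \ (S y \ T)).card ≤ ((S y \ T) \ (S z \ T)).card :=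
          Finset.card_sdiff_le_card_sdiff_iff.2 (hmax z hz)
        have h3 : (S y \ T) \ (S z \ T) ⊆ S y \ S z := by
          intro w; simp only [Finset.mem_sdiff]; tauto
        have h4 : S z \ (T ∪ S y) ⊆ (S z \ T) \ (S y \ T) := by
          intro w; simp only [Finset.mem_sdiff, Finset.mem_union]; tauto
        exact (Finset.card_le_card h4).trans (h2.trans ((Finset.card_le_card h3).trans h))
      · exact (Finset.card_le_card h1).trans h

end Greedy

/-! ### A bounded dominating set -/

section Undominated

variable {V : Type*} {G : SimpleGraph V}

/-- `v` neither belongs to `A` nor has a neighbor in `A`. -/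
def Undominated (G : SimpleGraph V) (A : Finset V) (v : V) : Prop :=
  v ∉ A ∧ ∀ u ∈ A, ¬ G.Adj u v

theorem Undominated.mono {A B : Finset V} (hAB : A ⊆ B) {v : V} (h : Undominated G B v) :
    Undominated G A v :=
  ⟨fun hv => h.1 (hAB hv), fun u hu => h.2 u (hAB hu)⟩

theorem Undominated.adj_trans (hG : InducedFree twoPathThree G) {A : Finset V} {x y z : V}
    (hx : x ∈ A) (hy : y ∈ A) (hz : z ∈ A) (hxy : G.Adj x y) (hyz : G.Adj y z) (hne : x ≠ z)
    (hxz : ¬ G.Adj x z) {u v w : V} (hu : Undominated G A u) (hv : Undominated G A v)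
    (hw : Undominated G A w) (huv : G.Adj u v) (hvw : G.Adj v w) (huw : u ≠ w) : G.Adj u w := by
  by_contra h
  exact hG.false_of_paths hxy hyz hne hxz huv hvw huw h (hu.2 x hx) (hv.2 x hx) (hw.2 x hx)
    (hu.2 y hy) (hv.2 y hy) (hw.2 y hy) (hu.2 z hz) (hv.2 z hz) (hw.2 z hz)

/-- Adding a bounded number of vertices to `A` makes the cliques of undominated vertices smaller. -/
theorem exists_superset_of_cliqueFree [Fintype V] (hG : InducedFree twoPathThree G)
    (hfree : G.CliqueFree 4)
    (hdeg : ∀ v, ∃ x y z, G.Adj v x ∧ G.Adj v y ∧ G.Adj v z ∧ x ≠ y ∧ x ≠ z ∧ y ≠ z)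
    (hcol : ∀ w, ∃ f : V → Fin 3, ∀ u v, u ≠ w → v ≠ w → G.Adj u v → f u ≠ f v)
    {A : Finset V} {x y z : V} (hx : x ∈ A) (hy : y ∈ A) (hz : z ∈ A) (hxy : G.Adj x y)
    (hyz : G.Adj y z) (hne : x ≠ z) (hxz : ¬ G.Adj x z) {s : ℕ} (hs : 0 < s)
    (hA : ∀ Q : Finset V, G.IsNClique (s + 1) Q → ∃ v ∈ Q, ¬ Undominated G A v) :
    ∃ B : Finset V, A ⊆ B ∧ B.card ≤ A.card + 7 ∧
      ∀ Q : Finset V, G.IsNClique s Q → ∃ v ∈ Q, ¬ Undominated G B v := by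
  classical
  set R := Undominated G A with hR
  have htrans : ∀ {u v w}, R u → R v → R w → G.Adj u v → G.Adj v w → u ≠ w → G.Adj u w :=
    fun hu hv hw => Undominated.adj_trans hG hx hy hz hxy hyz hne hxz hu hv hw
  -- `rep` chooses a representative of each component of the undominated vertices
  let r : Setoid V :=
    { r := fun u w => u = w ∨ (R u ∧ R w ∧ G.Adj u w)
      iseqv := by
        refine ⟨fun u => .inl rfl, ?_, ?_⟩
        · rintro u w (rfl | ⟨h1, h2, h3⟩)
          · exact .inl rfl
          · exact .inr ⟨h2, h1, h3.symm⟩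
        · rintro u v w (rfl | ⟨h1, h2, h3⟩) (rfl | ⟨h4, h5, h6⟩)
          · exact .inl rfl
          · exact .inr ⟨h4, h5, h6⟩
          · exact .inr ⟨h1, h2, h3⟩
          · by_cases huw : u = w
            · exact .inl huw
            · exact .inr ⟨h1, h5, htrans h1 h2 h5 h3 h6 huw⟩ }
  let rep : V → V := fun u => (Quotient.mk r u).out
  have hrep_eq : ∀ {u w}, R u → R w → G.Adj u w → rep u = rep w := fun hu hw h => by
    have : Quotient.mk r _ = Quotient.mk r _ := Quotient.sound (.inr ⟨hu, hw, h⟩)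
    simp only [rep, this]
  have hrep : ∀ {u w}, rep u = rep w → u = w ∨ (R u ∧ R w ∧ G.Adj u w) := fun {u w} h =>
    Quotient.exact (Quotient.out_inj.1 h)
  have hrep_rep : ∀ u, rep (rep u) = rep u := fun u => by simp [rep]
  have hrepR : ∀ {u}, R u → R (rep u) := fun {u} hu => by
    rcases hrep (hrep_rep u) with h | h
    · rwa [h]
    · exact h.1
  let S : V → Finset V := fun y => Finset.univ.filter fun c => ∃ u, R u ∧ G.Adj y u ∧ rep u = c
  have hS : ∀ {y c}, c ∈ S y ↔ ∃ u, R u ∧ G.Adj y u ∧ rep u = c := by simp [S]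
  -- `S y` is the set of components seen by `y`. Two components seen only by `y` and two seen only
  -- by `z` would give a `2P₃` with centers `y` and `z`.
  have hnested : ∀ y z, ¬ G.Adj y z → (S y \ S z).card ≤ 1 ∨ (S z \ S y).card ≤ 1 := by
    intro y z hyz
    by_contra! hcard
    obtain ⟨a, ha, b, hb, hab⟩ := Finset.one_lt_card.1 hcard.1
    obtain ⟨a', ha', b', hb', hab'⟩ := Finset.one_lt_card.1 hcard.2
    simp only [Finset.mem_sdiff] at ha hb ha' hb'
    obtain ⟨⟨u, hu, hyu, rfl⟩, hzu⟩ := And.imp_left hS.1 ha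
    obtain ⟨⟨w, hw, hyw, rfl⟩, hzw⟩ := And.imp_left hS.1 hb
    obtain ⟨⟨u', hu', hzu', rfl⟩, hyu'⟩ := And.imp_left hS.1 ha'
    obtain ⟨⟨w', hw', hzw', rfl⟩, hyw'⟩ := And.imp_left hS.1 hb'
    have hno : ∀ {p q}, R p → R q → rep p ≠ rep q → ¬ G.Adj p q := fun hp hq h h' =>
      h (hrep_eq hp hq h')
    have hcross : ∀ {p q}, rep p ∈ S y → rep q ∉ S y → rep p ≠ rep q := fun h1 h2 h => h2 (h ▸ h1)
    exact hG.false_of_paths hyu.symm hyw (fun h => hab (h ▸ rfl)) (hno hu hw hab) hzu'.symm hzw'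
      (fun h => hab' (h ▸ rfl)) (hno hu' hw' hab') (hno hu hu' (hcross ha.1 hyu'))
      (fun h => hzu (hS.2 ⟨u, hu, h.symm, rfl⟩)) (hno hu hw' (hcross ha.1 hyw'))
      (fun h => hyu' (hS.2 ⟨u', hu', h, rfl⟩)) hyz (fun h => hyw' (hS.2 ⟨w', hw', h, rfl⟩))
      (hno hw hu' (hcross hb.1 hyu')) (fun h => hzw (hS.2 ⟨w, hw, h.symm, rfl⟩))
      (hno hw hw' (hcross hb.1 hyw'))
  obtain ⟨P, hP, hcov⟩ := exists_greedy_cover hnested 4 Finset.univ ∅ fun Q _ => hfree Q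
  set T := P.biUnion S with hT
  rw [Finset.empty_union] at hcov
  let U : Finset V := Finset.univ.filter fun c => R c ∧ rep c = c ∧ c ∉ T
  -- each uncovered component has its own color
  obtain ⟨f, hf⟩ := hcol x
  have hnx : ∀ {c w}, R c → G.Adj c w → w ≠ x := fun hc hcw h => hc.2 x hx (h ▸ hcw.symm)
  have hpair : ∀ c, R c → ∃ w w', G.Adj c w ∧ G.Adj c w' ∧ w ≠ w' ∧ f w = f w' := by
    intro c hc
    obtain ⟨a, b, d, ha, hb, hd, hab, had, hbd⟩ := hdeg c
    have hcx : c ≠ x := fun h => hc.1 (h ▸ hx)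
    have h1 := hf c a hcx (hnx hc ha) ha
    have h2 := hf c b hcx (hnx hc hb) hb
    have h3 := hf c d hcx (hnx hc hd) hd
    rcases (show f a = f b ∨ f a = f d ∨ f b = f d by omega) with h | h | h
    · exact ⟨a, b, ha, hb, hab, h⟩
    · exact ⟨a, d, ha, hd, had, h⟩
    · exact ⟨b, d, hb, hd, hbd, h⟩
  choose! w w' hw hw' hww' hfw using hpair
  -- Each `c ∈ U` has two neighbors of the same color. If two members of `U` shared this color,
  -- their paths would form `2P₃`: equal colors exclude edges between the ends, and no vertex sees
  -- two uncovered components.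
  have hUcard : U.card ≤ 3 := by
    have hinj : Set.InjOn (fun c => f (w c)) U := by
      intro c hc c' hc' heq
      obtain ⟨-, hcR, hcc, hcT⟩ := Finset.mem_filter.1 (Finset.mem_coe.1 hc)
      obtain ⟨-, hcR', hcc', hcT'⟩ := Finset.mem_filter.1 (Finset.mem_coe.1 hc')
      by_contra hne
      have hone : ∀ v, ¬ (G.Adj c v ∧ G.Adj c' v) := fun v hv => by
        refine absurd (hcov v (Finset.mem_univ _)) (not_le.2 (Finset.one_lt_card.2
          ⟨c, Finset.mem_sdiff.2 ⟨hS.2 ⟨c, hcR, hv.1.symm, hcc⟩, hcT⟩,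
          c', Finset.mem_sdiff.2 ⟨hS.2 ⟨c', hcR', hv.2.symm, hcc'⟩, hcT'⟩, hne⟩))
      have hsame : ∀ {p q}, p ≠ x → q ≠ x → f p = f q → ¬ G.Adj p q := fun hp hq h h' =>
        hf _ _ hp hq h' h
      have n1 := hnx hcR (hw c hcR)
      have n2 := hnx hcR (hw' c hcR)
      have n3 := hnx hcR' (hw c' hcR')
      have n4 := hnx hcR' (hw' c' hcR')
      have e1 := hfw c hcR
      have e2 := hfw c' hcR'
      simp only at heq
      exact hG.false_of_paths (hw c hcR).symm (hw' c hcR) (hww' c hcR) (hsame n1 n2 e1)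
        (hw c' hcR').symm (hw' c' hcR') (hww' c' hcR') (hsame n3 n4 e2)
        (hsame n1 n3 heq) (fun h => hone _ ⟨hw c hcR, h.symm⟩) (hsame n1 n4 (heq.trans e2))
        (fun h => hone _ ⟨h, hw c' hcR'⟩)
        (fun h => hne (by rw [← hcc, ← hcc']; exact hrep_eq hcR hcR' h))
        (fun h => hone _ ⟨h, hw' c' hcR'⟩)
        (hsame n2 n3 (e1.symm.trans heq)) (fun h => hone _ ⟨hw' c hcR, h.symm⟩)
        (hsame n2 n4 ((e1.symm.trans heq).trans e2))
    simpa using Finset.card_le_card_of_injOn (t := Finset.univ) _ (fun _ _ => Finset.mem_univ _)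
      hinj
  refine ⟨A ∪ (P ∪ U), Finset.subset_union_left, ?_, fun Q hQ => ?_⟩
  · have h1 := Finset.card_union_le A (P ∪ U)
    have h2 := Finset.card_union_le P U
    omega
  by_contra! hQB
  have hQR : ∀ q ∈ Q, R q := fun q hq => (hQB q hq).mono Finset.subset_union_left
  obtain ⟨q, hq⟩ : Q.Nonempty := Finset.card_pos.1 (hQ.card_eq ▸ hs)
  obtain ⟨u, huR, hurep, huB⟩ : ∃ u, R u ∧ rep u = rep q ∧ ¬ Undominated G (A ∪ (P ∪ U)) u := by
    by_cases hqT : rep q ∈ T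
    · obtain ⟨y, hy, hyq⟩ := Finset.mem_biUnion.1 hqT
      obtain ⟨u, hu, hyu, hru⟩ := hS.1 hyq
      exact ⟨u, hu, hru, fun h => h.2 y (by simp [hy]) hyu⟩
    · have hqU : rep q ∈ U := Finset.mem_filter.2
        ⟨Finset.mem_univ _, hrepR (hQR q hq), hrep_rep q, hqT⟩
      exact ⟨rep q, hrepR (hQR q hq), hrep_rep q, fun h => h.1 (by simp [hqU])⟩
  -- `u` lies in the component of `Q` but is hit or dominated by the new set, so it enlarges `Q` to
  -- a clique excluded by `hA`.
  have huQ : ∀ q' ∈ Q, G.Adj u q' := by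
    intro q' hq'
    have hne : u ≠ q' := fun h => huB (h ▸ hQB q' hq')
    have hqq' : rep q = rep q' := by
      by_cases h : q = q'
      · rw [h]
      · exact hrep_eq (hQR q hq) (hQR q' hq') (hQ.isClique hq hq' h)
    exact ((hrep (hurep.trans hqq')).resolve_left hne).2.2
  obtain ⟨v, hv, hvR⟩ := hA _ (hQ.insert huQ)
  rcases Finset.mem_insert.1 hv with rfl | hv
  · exact hvR huR
  · exact hvR (hQR v hv)

/-- A bounded dominating set. -/
theorem exists_dominating [Fintype V] (hG : InducedFree twoPathThree G)
    (hfree : G.CliqueFree 4)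
    (hdeg : ∀ v, ∃ x y z, G.Adj v x ∧ G.Adj v y ∧ G.Adj v z ∧ x ≠ y ∧ x ≠ z ∧ y ≠ z)
    (hcol : ∀ w, ∃ f : V → Fin 3, ∀ u v, u ≠ w → v ≠ w → G.Adj u v → f u ≠ f v) [Nonempty V] :
    ∃ A : Finset V, A.card ≤ 24 ∧ ∀ v, v ∈ A ∨ ∃ u ∈ A, G.Adj u v := by
  classical
  obtain ⟨x, y, z, hxy, hyz, hne, hxz⟩ :
      ∃ x y z, G.Adj x y ∧ G.Adj y z ∧ x ≠ z ∧ ¬ G.Adj x z := by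
    obtain ⟨v⟩ := ‹Nonempty V›
    obtain ⟨a, b, c, ha, hb, hc, hab, hac, hbc⟩ := hdeg v
    by_contra! hno
    have h3 : G.IsNClique 3 {a, b, c} := SimpleGraph.is3Clique_triple_iff.2
      ⟨hno a v b ha.symm hb hab, hno a v c ha.symm hc hac, hno b v c hb.symm hc hbc⟩
    exact hfree _ (h3.insert (a := v) (by simp [ha, hb, hc]))
  obtain ⟨A₁, h1, hc1, hA₁⟩ := exists_superset_of_cliqueFree hG hfree hdeg hcol
    (A := {x, y, z}) (x := x) (y := y) (z := z) (by simp) (by simp) (by simp) hxy hyz hne hxz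
    (s := 3) (by omega) (fun Q hQ => absurd hQ (hfree Q))
  have hx := h1 (show x ∈ _ by simp)
  have hy := h1 (show y ∈ _ by simp)
  have hz := h1 (show z ∈ _ by simp)
  obtain ⟨A₂, h2, hc2, hA₂⟩ := exists_superset_of_cliqueFree hG hfree hdeg hcol hx hy hz hxy hyz
    hne hxz (by omega) hA₁
  obtain ⟨A₃, h3, hc3, hA₃⟩ := exists_superset_of_cliqueFree hG hfree hdeg hcol (h2 hx) (h2 hy)
    (h2 hz) hxy hyz hne hxz (by omega) hA₂
  refine ⟨A₃, ?_, fun v => ?_⟩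
  -- Three rounds of seven vertices on top of the path: `24 = 3 + 3 * 7`.
  · have := Finset.card_le_three (a := x) (b := y) (c := z)
    omega
  · obtain ⟨u, hu, huA⟩ := hA₃ {v} (by simp)
    obtain rfl := Finset.mem_singleton.1 hu
    by_contra! h
    exact huA h

end Undominated

/-! ### Vertex-critical graphs -/

section Critical

variable {V : Type*} {G : SimpleGraph V}

/-- With at most two neighbors, `v` could be given a free color in a `3`-coloring of the rest. -/
theorem IsVertexCritical.exists_three_neighbors [Fintype V] (h : IsVertexCritical G 4) (v : V) :
    ∃ x y z, G.Adj v x ∧ G.Adj v y ∧ G.Adj v z ∧ x ≠ y ∧ x ≠ z ∧ y ≠ z := by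
  classical
  by_contra hno
  obtain ⟨c⟩ := h.2 {v}ᶜ (by simp)
  let f : V → Fin 3 := fun u => if hu : u ∈ ({v}ᶜ : Set V) then c ⟨u, hu⟩ else 0
  let N : Finset V := Finset.univ.filter fun u => G.Adj v u
  have hN : N.card ≤ 2 := by
    by_contra! hN
    obtain ⟨x, y, z, hx, hy, hz, hne⟩ := Finset.two_lt_card_iff.1 hN
    simp only [N, Finset.mem_filter, Finset.mem_univ, true_and] at hx hy hz
    exact hno ⟨x, y, z, hx, hy, hz, hne⟩
  obtain ⟨a, ha⟩ : ∃ a, a ∉ N.image f := by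
    by_contra! hall
    have h1 : (Finset.univ : Finset (Fin 3)).card ≤ (N.image f).card :=
      Finset.card_le_card fun a _ => hall a
    have h2 := Finset.card_image_le (s := N) (f := f)
    simp only [Finset.card_univ, Fintype.card_fin] at h1
    omega
  have hfa : ∀ u, G.Adj v u → f u ≠ a := fun u hu h' =>
    ha (Finset.mem_image.2 ⟨u, by simp [N, hu], h'⟩)
  refine h.1.2 ⟨SimpleGraph.Coloring.mk (fun u => if u = v then a else f u) ?_⟩
  intro u w huw
  by_cases hu : u = v <;> by_cases hw : w = v
  · exact absurd (hu.trans hw.symm) huw.ne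
  · simpa [hu, hw] using (hfa w (hu ▸ huw)).symm
  · simpa [hu, hw] using hfa u (hw ▸ huw.symm)
  · simp only [hu, hw, if_false, f, Set.mem_compl_iff, Set.mem_singleton_iff, not_false_eq_true,
      dif_pos]
    exact c.valid (by simpa using huw)

theorem IsVertexCritical.exists_coloring_off (h : IsVertexCritical G 4) (w : V) :
    ∃ f : V → Fin 3, ∀ u v, u ≠ w → v ≠ w → G.Adj u v → f u ≠ f v := by
  classical
  obtain ⟨c⟩ := h.2 {w}ᶜ (by simp)
  refine ⟨fun u => if hu : u ∈ ({w}ᶜ : Set V) then c ⟨u, hu⟩ else 0, fun u v hu hv huv => ?_⟩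
  simp only [Set.mem_compl_iff, Set.mem_singleton_iff, hu, hv, not_false_eq_true, dif_pos]
  exact c.valid (by simpa using huv)

theorem IsVertexCritical.card_eq_of_not_colorable [Fintype V] (h : IsVertexCritical G 4)
    {Y : Finset V} (hY : ¬ (G.induce (Y : Set V)).Colorable 3) : Fintype.card V = Y.card := by
  have hU : (Y : Set V) = Set.univ := by
    by_contra hne
    exact hY (h.2 _ hne)
  rw [Finset.coe_eq_univ.1 hU, Finset.card_univ]

/-- A bound for the number of vertices of `2P₃`-free `4`-vertex-critical graphs. -/
def criticalBound : ℕ :=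
  4 + (Finset.range 25).sup fun k => k + 3 ^ k * witnessBound k

theorem IsVertexCritical.card_le [Fintype V] (hG : InducedFree twoPathThree G)
    (h : IsVertexCritical G 4) : Fintype.card V ≤ criticalBound := by
  classical
  by_cases hfree : G.CliqueFree 4
  · have : Nonempty V := by
      by_contra hV
      rw [not_nonempty_iff] at hV
      exact h.1.2 ⟨SimpleGraph.Coloring.mk (fun _ => 0) fun {u} => isEmptyElim u⟩
    obtain ⟨A, hA, hdom⟩ := exists_dominating hG hfree h.exists_three_neighbors
      h.exists_coloring_off
    obtain ⟨Y, hY, hYc⟩ := exists_small_not_colorable hG hdom h.1.2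
    rw [h.card_eq_of_not_colorable hYc]
    refine (hY.trans ?_).trans (Nat.le_add_left _ _)
    exact Finset.le_sup (f := fun k => k + 3 ^ k * witnessBound k)
      (Finset.mem_range.2 (Nat.lt_succ_of_le hA))
  · simp only [SimpleGraph.CliqueFree, not_forall, not_not] at hfree
    obtain ⟨Q, hQ⟩ := hfree
    rw [h.card_eq_of_not_colorable (Y := Q), hQ.card_eq]
    · exact Nat.le_add_right _ _
    · rintro ⟨c⟩
      have hinj : Function.Injective c := fun x y hxy => by
        by_contra hne
        exact c.valid (hQ.isClique x.2 y.2 fun h' => hne (Subtype.ext h')) hxy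
      have := Fintype.card_le_of_injective c hinj
      simp [hQ.card_eq] at this

end Critical

/-! ### The main theorem -/

theorem mainTheorem5 :
    -- the number of vertices of a `2P₃`-free 4-vertex-critical graph is bounded
    (∃ C : ℕ, 0 < C ∧ ∀ (V : Type u) [Fintype V] (G : SimpleGraph V),
      InducedFree twoPathThree G → IsVertexCritical G 4 → Fintype.card V ≤ C) ∧
    -- there are only finitely many such graphs up to isomorphism
    (∃ S : Finset (Σ n : ℕ, SimpleGraph (Fin n)),
      ∀ (V : Type u) [Fintype V] (G : SimpleGraph V),
        InducedFree twoPathThree G → IsVertexCritical G 4 →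
          ∃ H ∈ S, Nonempty (G ≃g H.2)) ∧
    -- the list version fails: `2P₃`-free minimal list-obstructions are arbitrarily large
    (∀ C : ℕ, ∃ (n : ℕ) (G : SimpleGraph (Fin n)) (L : Fin n → Finset (Fin 3)),
      C < n ∧ InducedFree twoPathThree G ∧ IsMinimalListObstruction G L) ∧
    -- and there are infinitely many of them up to isomorphism
    (¬ ∃ S : Finset (Σ n : ℕ, SimpleGraph (Fin n) × (Fin n → Finset (Fin 3))),
      ∀ (V : Type u) [Fintype V] (G : SimpleGraph V) (L : V → Finset (Fin 3)),
        InducedFree twoPathThree G → IsMinimalListObstruction G L →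
          ∃ H ∈ S, ListIsomorphic G L H.2.1 H.2.2) := by
  classical
  obtain ⟨C, hC0, hC⟩ : ∃ C : ℕ, 0 < C ∧ ∀ (V : Type u) [Fintype V] (G : SimpleGraph V),
      InducedFree twoPathThree G → IsVertexCritical G 4 → Fintype.card V ≤ C :=
    ⟨criticalBound, Nat.lt_of_lt_of_le four_pos (Nat.le_add_right _ _),
      fun V _ G hG h => h.card_le hG⟩
  refine ⟨⟨C, hC0, hC⟩, ?_, ?_, ?_⟩
  · refine ⟨(Finset.range (C + 1)).sigma fun n =>
      (Set.toFinite (Set.univ : Set (SimpleGraph (Fin n)))).toFinset, fun V _ G hG h => ?_⟩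
    exact ⟨⟨Fintype.card V, G.overFin rfl⟩, Finset.mem_sigma.2
      ⟨Finset.mem_range.2 (Nat.lt_succ_of_le (hC V G hG h)), by simp⟩, ⟨G.overFinIso rfl⟩⟩
  · intro C
    exact ⟨3 * (C + 1), halfGraph (Equiv.refl _), _, by omega, halfGraph_inducedFree _,
      halfGraph_isMinimalListObstruction (Nat.succ_pos C) _⟩
  · rintro ⟨S, hS⟩
    let C := S.sup fun H => H.1
    -- The obstruction has to live in universe `u`; its size exceeds that of every member of `S`.
    let e : ULift.{u} (Fin (3 * (C + 1))) ≃ Fin (3 * (C + 1)) := Equiv.ulift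
    obtain ⟨H, hH, φ, -⟩ := hS _ (halfGraph e) _ (halfGraph_inducedFree e)
      (halfGraph_isMinimalListObstruction (Nat.succ_pos C) e)
    have h1 := Fintype.card_congr φ.toEquiv
    have h2 : H.1 ≤ C := Finset.le_sup (f := fun H => H.1) hH
    simp only [Fintype.card_ulift, Fintype.card_fin] at h1
    omega
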